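/- Let $H$ be an infinite dimensional (not necessarily separable) complex Hilbert space. A bounded operator $T$ on $H$ is \emph{absolutely minimum attaining} if for every nonzero closed subspace $M\subseteq H$ there is a unit vector $x_0\in M$ with $\|Tx_0\|=\inf\{\|Tx\| : x\in M,\ \|x\|=1\}$. A positive absolutely minimum attaining operator is of \emph{first type} if it has no eigenvalue of infinite multiplicity, and of \emph{second type} if it has exactly one eigenvalue of infinite multiplicity. Let $T$ be a bounded operator on $H$. Then the following are equivalent: (1) $T$ is positive and absolutely minimum attaining; (2) there is a unique triple $(\alpha,K,F)$ such that $T=\alpha I-K+F$, where $\alpha\in\mathbb{R}$, $K$ is a positive compact operator with $\|K\|\le\alpha$, $F$ is a positive finite rank operator, and $KF=FK=0$. Moreover, for every such decomposition $T=\alpha I-K+F$: (a) $T$ is of first type if and only if the null space $N(K-F)$ is finite dimensional; (b) $T$ is of second type if and only if the null space $N(K-F)$ is infinite dimensional. -/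

import Mathlib

/-- The minimum modulus `m(T) = inf {‖T x‖ : ‖x‖ = 1}` of a bounded operator. -/
noncomputable def minimumModulus {E F : Type*} [NormedAddCommGroup E] [InnerProductSpace ℂ E]
    [NormedAddCommGroup F] [InnerProductSpace ℂ F] (T : E →L[ℂ] F) : ℝ :=
  sInf {r : ℝ | ∃ x : E, ‖x‖ = 1 ∧ r = ‖T x‖}

/-- `T` is minimum attaining: `‖T x₀‖ = m(T)` for some unit vector `x₀`. -/
def IsMinimumAttaining {E F : Type*} [NormedAddCommGroup E] [InnerProductSpace ℂ E]
    [NormedAddCommGroup F] [InnerProductSpace ℂ F] (T : E →L[ℂ] F) : Prop :=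
  ∃ x₀ : E, ‖x₀‖ = 1 ∧ ‖T x₀‖ = minimumModulus T

/-- `T` is absolutely minimum attaining: its restriction `T|_M : M → F` to every nonzero closed
subspace `M` is minimum attaining. -/
def IsAbsolutelyMinimumAttaining {E F : Type*} [NormedAddCommGroup E] [InnerProductSpace ℂ E]
    [NormedAddCommGroup F] [InnerProductSpace ℂ F] (T : E →L[ℂ] F) : Prop :=
  ∀ M : Submodule ℂ E, IsClosed (M : Set E) → M ≠ ⊥ → IsMinimumAttaining (T.comp M.subtypeL)

/-- The positive absolutely minimum attaining operators on `H`. -/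
def IsPositiveAM {H : Type*} [NormedAddCommGroup H] [InnerProductSpace ℂ H]
    (T : H →L[ℂ] H) : Prop :=
  IsAbsolutelyMinimumAttaining T ∧ T.IsPositive

/-- `μ` is an eigenvalue of `T` whose eigenspace `N(T - μ I)` is infinite dimensional. -/
def IsEigenvalueOfInfiniteMultiplicity {H : Type*} [NormedAddCommGroup H] [InnerProductSpace ℂ H]
    (T : H →L[ℂ] H) (μ : ℂ) : Prop :=
  Module.End.HasEigenvalue (T : H →ₗ[ℂ] H) μ ∧
    ¬ FiniteDimensional ℂ (Module.End.eigenspace (T : H →ₗ[ℂ] H) μ)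

/-- A positive absolutely minimum attaining operator is of first type if it has no eigenvalue of
infinite multiplicity. -/
def IsFirstType {H : Type*} [NormedAddCommGroup H] [InnerProductSpace ℂ H]
    (T : H →L[ℂ] H) : Prop :=
  IsPositiveAM T ∧ ¬ ∃ μ : ℂ, IsEigenvalueOfInfiniteMultiplicity T μ

/-- A positive absolutely minimum attaining operator is of second type if it has a unique
eigenvalue of infinite multiplicity. -/
def IsSecondType {H : Type*} [NormedAddCommGroup H] [InnerProductSpace ℂ H]
    (T : H →L[ℂ] H) : Prop :=
  IsPositiveAM T ∧ ∃! μ : ℂ, IsEigenvalueOfInfiniteMultiplicity T μ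

/-- `T = α I - K + F` with `K` positive compact, `‖K‖ ≤ α`, `F` positive of finite rank, and
`K F = F K = 0`. -/
structure IsAMDecomposition {H : Type*} [NormedAddCommGroup H] [InnerProductSpace ℂ H]
    (T : H →L[ℂ] H) (α : ℝ) (K F : H →L[ℂ] H) : Prop where
  eq : T = (α : ℂ) • ContinuousLinearMap.id ℂ H - K + F
  positive_K : K.IsPositive
  compact_K : IsCompactOperator K
  norm_K_le : ‖K‖ ≤ α
  positive_F : F.IsPositive
  finiteRank_F : FiniteDimensional ℂ (LinearMap.range (F : H →ₗ[ℂ] H))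
  comp_KF : K.comp F = 0
  comp_FK : F.comp K = 0

open scoped InnerProductSpace Topology
open Filter

/-! A decomposition makes `T - α` compact. On a closed subspace `M` with inclusion `J` and `S = T
J`, the operator `S† S - α²` is then compact. If the minimum modulus of `S` is below `α`, a
minimising sequence consists of approximate eigenvectors of `S† S`, and compactness extracts a
limit. Otherwise either `M` contains a unit vector of `N(F)`, where `‖T x‖ ≤ α` attains the minimum,
or `F` is injective on `M` and `M` is finite dimensional.

Conversely, on an invariant closed subspace a minimiser is an eigenvector, so Zorn's lemma yields an
orthonormal eigenbasis. Infinitely many eigenvalues on both sides of a gap could be paired into an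
orthogonal sequence contradicting `not_strictAnti`. Hence the eigenvalues cluster at one `α` only,
finitely many exceed it (`finite_setOf_lt`), and `F`, `K` are the positive and negative parts of `T
- α`.

Two different values of `α` would make the identity compact; given `α`, uniqueness of positive and
negative parts fixes `F` and `K`. Compactness of `F - K` leaves `α` as the only possible eigenvalue
of infinite multiplicity. -/

theorem inner_self_eq_ofReal_norm_sq {E : Type*} [NormedAddCommGroup E] [InnerProductSpace ℂ E]
    (x : E) : ⟪x, x⟫_ℂ = ((‖x‖ ^ 2 : ℝ) : ℂ) := by
  rw [inner_self_eq_norm_sq_to_K]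
  push_cast
  rfl

/-! ### Positive operators and the quadratic form of `S† S - m²` -/

namespace ContinuousLinearMap

variable {E F : Type*} [NormedAddCommGroup E] [InnerProductSpace ℂ E] [CompleteSpace E]
  [NormedAddCommGroup F] [InnerProductSpace ℂ F] [CompleteSpace F]

/-- A positive operator satisfies `‖B x‖² ≤ ‖B‖ ⟪B x, x⟫`. -/
theorem IsPositive.norm_sq_apply_le {B : E →L[ℂ] E} (hB : B.IsPositive) (x : E) :
    ‖B x‖ ^ 2 ≤ ‖B‖ * (⟪B x, x⟫_ℂ).re := by
  have hB0 : 0 ≤ B := (nonneg_iff_isPositive B).2 hB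
  -- With `S = √B`, `⟪B x, x⟫ = ‖S x‖²` and `‖B‖ = ‖S‖²`, so the bound is `‖S (S x)‖ ≤ ‖S‖ ‖S x‖`
  -- squared.
  set S := CFC.sqrt B with hS
  have hSS : S * S = B := CFC.sqrt_mul_sqrt_self B hB0
  have hSp : S.IsPositive := (nonneg_iff_isPositive S).1 (CFC.sqrt_nonneg B)
  have hSn : ‖S‖ * ‖S‖ = ‖B‖ := by
    rw [← hSS, ← CStarRing.norm_star_mul_self, hSp.isSelfAdjoint.star_eq]
  have h1 : B x = S (S x) := by rw [← hSS]; rfl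
  have h2 : (⟪B x, x⟫_ℂ).re = ‖S x‖ ^ 2 := by
    rw [h1, hSp.inner_left_eq_inner_right, ← inner_self_eq_norm_sq (𝕜 := ℂ)]; rfl
  rw [h2, ← hSn, h1]
  calc ‖S (S x)‖ ^ 2 ≤ (‖S‖ * ‖S x‖) ^ 2 := by gcongr; exact S.le_opNorm _
    _ = _ := by ring

theorem IsPositive.apply_eq_zero_of_inner_eq_zero {B : E →L[ℂ] E} (hB : B.IsPositive) {x : E}
    (hx : (⟪B x, x⟫_ℂ).re = 0) : B x = 0 := by
  have := hB.norm_sq_apply_le x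
  rw [hx, mul_zero] at this
  exact norm_eq_zero.1 (pow_eq_zero_iff two_ne_zero |>.1 (le_antisymm this (sq_nonneg _)))

/-- The operator `S† S - m² I`. -/
noncomputable def gap (S : E →L[ℂ] F) (m : ℝ) : E →L[ℂ] E :=
  (adjoint S).comp S - ((m ^ 2 : ℝ) : ℂ) • ContinuousLinearMap.id ℂ E

theorem inner_gap (S : E →L[ℂ] F) (m : ℝ) (x y : E) :
    ⟪gap S m x, y⟫_ℂ = ⟪S x, S y⟫_ℂ - ((m ^ 2 : ℝ) : ℂ) * ⟪x, y⟫_ℂ := by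
  simp only [gap, sub_apply, comp_apply, smul_apply, id_apply, inner_sub_left, inner_smul_left,
    adjoint_inner_left, Complex.conj_ofReal]

theorem re_inner_gap_self (S : E →L[ℂ] F) (m : ℝ) (x : E) :
    (⟪gap S m x, x⟫_ℂ).re = ‖S x‖ ^ 2 - m ^ 2 * ‖x‖ ^ 2 := by
  rw [inner_gap, inner_self_eq_ofReal_norm_sq, inner_self_eq_ofReal_norm_sq,
    ← Complex.ofReal_mul, ← Complex.ofReal_sub, Complex.ofReal_re]

theorem isPositive_gap {S : E →L[ℂ] F} {m : ℝ} (hm : 0 ≤ m) (h : ∀ y, m * ‖y‖ ≤ ‖S y‖) :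
    (gap S m).IsPositive := by
  rw [isPositive_iff_complex]
  intro x
  have h1 : ((⟪gap S m x, x⟫_ℂ).re : ℂ) = ⟪gap S m x, x⟫_ℂ := by
    rw [re_inner_gap_self, inner_gap, inner_self_eq_ofReal_norm_sq, inner_self_eq_ofReal_norm_sq]
    push_cast
    rfl
  refine ⟨h1, ?_⟩
  change 0 ≤ (⟪gap S m x, x⟫_ℂ).re
  rw [re_inner_gap_self, ← mul_pow, sub_nonneg]
  exact pow_le_pow_left₀ (by positivity) (h x) 2

/-- At a point where the lower bound `m ‖y‖ ≤ ‖S y‖` is attained, `S† S x = m² x`. -/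
theorem inner_apply_eq_of_norm_apply_eq {S : E →L[ℂ] F} {m : ℝ} (hm : 0 ≤ m)
    (h : ∀ y, m * ‖y‖ ≤ ‖S y‖) {x : E} (hx : ‖S x‖ = m * ‖x‖) (y : E) :
    ⟪S x, S y⟫_ℂ = ((m ^ 2 : ℝ) : ℂ) * ⟪x, y⟫_ℂ := by
  have h0 := (isPositive_gap hm h).apply_eq_zero_of_inner_eq_zero (x := x)
    (by rw [re_inner_gap_self, hx]; ring)
  have := inner_gap S m x y
  rw [h0, inner_zero_left] at this
  exact (sub_eq_zero.1 this.symm)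

end ContinuousLinearMap

/-! ### Minimisers and their first-order condition -/

section MinimumModulus

variable {E F : Type*} [NormedAddCommGroup E] [InnerProductSpace ℂ E]
  [NormedAddCommGroup F] [InnerProductSpace ℂ F]

theorem minimumModulus_nonneg (T : E →L[ℂ] F) : 0 ≤ minimumModulus T :=
  Real.sInf_nonneg (by rintro _ ⟨x, -, rfl⟩; exact norm_nonneg _)

theorem minimumModulus_le (T : E →L[ℂ] F) {x : E} (hx : ‖x‖ = 1) : minimumModulus T ≤ ‖T x‖ :=
  csInf_le ⟨0, by rintro _ ⟨x, -, rfl⟩; exact norm_nonneg _⟩ ⟨x, hx, rfl⟩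

theorem minimumModulus_mul_norm_le (T : E →L[ℂ] F) (x : E) :
    minimumModulus T * ‖x‖ ≤ ‖T x‖ := by
  rcases eq_or_ne x 0 with rfl | hx
  · simp
  have h := minimumModulus_le T (norm_smul_inv_norm (𝕜 := ℂ) hx)
  rw [map_smul, norm_smul] at h
  have hx' : 0 < ‖x‖ := norm_pos_iff.2 hx
  simp only [norm_inv, RCLike.norm_ofReal, abs_norm] at h
  rwa [← div_eq_inv_mul, le_div_iff₀ hx'] at h

theorem isMinimumAttaining_of_le {T : E →L[ℂ] F} {x : E} (hx : ‖x‖ = 1)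
    (h : ∀ y, ‖y‖ = 1 → ‖T x‖ ≤ ‖T y‖) : IsMinimumAttaining T :=
  ⟨x, hx, le_antisymm (le_csInf ⟨_, x, hx, rfl⟩ (by rintro _ ⟨y, hy, rfl⟩; exact h y hy))
    (minimumModulus_le T hx)⟩

variable [CompleteSpace E] [CompleteSpace F]

/-- The last clause is the Euler–Lagrange equation: `T† T x - m² x` is orthogonal to `M`, even when
`M` is not invariant. -/
theorem IsAbsolutelyMinimumAttaining.exists_minimizer {T : E →L[ℂ] F}
    (hT : IsAbsolutelyMinimumAttaining T) {M : Submodule ℂ E} (hM : IsClosed (M : Set E))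
    (hM0 : M ≠ ⊥) :
    ∃ m : ℝ, 0 ≤ m ∧ (∀ y ∈ M, m * ‖y‖ ≤ ‖T y‖) ∧ ∃ x ∈ M, ‖x‖ = 1 ∧ ‖T x‖ = m ∧
      ∀ y ∈ M, ⟪T x, T y⟫_ℂ = ((m ^ 2 : ℝ) : ℂ) * ⟪x, y⟫_ℂ := by
  obtain ⟨x, hx, hxm⟩ := hT M hM hM0
  have : CompleteSpace M := hM.completeSpace_coe
  set S := T.comp M.subtypeL with hS
  have hle := minimumModulus_mul_norm_le S
  refine ⟨minimumModulus S, minimumModulus_nonneg S, fun y hy => hle ⟨y, hy⟩, x, x.2, hx, hxm,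
    fun y hy => ?_⟩
  exact ContinuousLinearMap.inner_apply_eq_of_norm_apply_eq (minimumModulus_nonneg S) hle
    (x := x) (by rw [hxm, hx, mul_one]) ⟨y, hy⟩

/-- No orthogonal sequence with orthogonal images has strictly decreasing ratios
`‖T fₙ‖² / ‖fₙ‖²`. -/
theorem IsAbsolutelyMinimumAttaining.not_strictAnti {T : E →L[ℂ] F}
    (hT : IsAbsolutelyMinimumAttaining T) {f : ℕ → E} {t : ℕ → ℝ} (hf0 : ∀ n, f n ≠ 0)
    (hf : Pairwise fun n k => ⟪f n, f k⟫_ℂ = 0) (hTf : Pairwise fun n k => ⟪T (f n), T (f k)⟫_ℂ = 0)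
    (ht : ∀ n, ‖T (f n)‖ ^ 2 = t n * ‖f n‖ ^ 2) : ¬ StrictAnti t := by
  intro hanti
  set M := (Submodule.span ℂ (Set.range f)).topologicalClosure with hM
  have hfM : ∀ n, f n ∈ M := fun n =>
    Submodule.le_topologicalClosure _ (Submodule.subset_span ⟨n, rfl⟩)
  have hM0 : M ≠ ⊥ := fun h => hf0 0 (by simpa [h] using hfM 0)
  obtain ⟨m, hm, hle, x, hxM, hx, -, hvar⟩ :=
    hT.exists_minimizer (Submodule.isClosed_topologicalClosure _) hM0
  -- Strict, because `m² ≤ t (n + 1) < t n`.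
  have hmt : ∀ n, m ^ 2 < t n := fun n => by
    refine lt_of_le_of_lt ?_ (hanti (Nat.lt_succ_self n))
    have h1 := pow_le_pow_left₀ (by positivity) (hle _ (hfM (n + 1))) 2
    rw [ht, mul_pow] at h1
    exact le_of_mul_le_mul_right h1 (pow_pos (norm_pos_iff.2 (hf0 _)) 2)
  -- a continuous linear functional vanishing on the generators vanishes on `M`
  have hext : ∀ g : E →L[ℂ] ℂ, (∀ k, g (f k) = 0) → ∀ y ∈ M, g y = 0 := fun g hg y hy => by
    have hle : M ≤ LinearMap.ker (g : E →ₗ[ℂ] ℂ) := by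
      refine Submodule.topologicalClosure_minimal _ (Submodule.span_le.2 ?_) g.isClosed_ker
      rintro _ ⟨k, rfl⟩
      exact hg k
    exact hle hy
  have hTn : ∀ n, ∀ y ∈ M, ⟪T (f n), T y⟫_ℂ = (t n : ℂ) * ⟪f n, y⟫_ℂ := fun n y hy => by
    have := hext ((innerSL ℂ (T (f n))).comp T - (t n : ℂ) • innerSL ℂ (f n)) (fun k => ?_) y hy
    · simpa [sub_eq_zero] using this
    · rcases eq_or_ne n k with rfl | hnk
      · simp only [sub_apply, ContinuousLinearMap.comp_apply, smul_apply, innerSL_apply_apply,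
          inner_self_eq_ofReal_norm_sq, smul_eq_mul, sub_eq_zero]
        exact_mod_cast ht n
      · simp [hf hnk, hTf hnk]
  -- Two evaluations of `⟪T x, T (f n)⟫`, one from `x` and one from `f n`, give `(m² - t n) ⟪x, f n⟫
  -- = 0`.
  have hzero : ∀ n, ⟪x, f n⟫_ℂ = 0 := fun n => by
    have h1 := hvar _ (hfM n)
    have h2 := hTn n x hxM
    rw [← inner_conj_symm, h2, map_mul, inner_conj_symm, Complex.conj_ofReal, ← sub_eq_zero,
      ← sub_mul] at h1
    refine (mul_eq_zero.1 h1).resolve_left ?_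
    rw [← Complex.ofReal_sub]
    exact_mod_cast (sub_pos.2 (hmt n)).ne'
  have := hext (innerSL ℂ x) hzero x hxM
  rw [innerSL_apply_apply, inner_self_eq_zero] at this
  simp [this] at hx

end MinimumModulus

theorem isCompactOperator_of_finiteDimensional_range {E F : Type*} [NormedAddCommGroup E]
    [NormedSpace ℂ E] [NormedAddCommGroup F] [NormedSpace ℂ F] (A : E →L[ℂ] F)
    (hA : FiniteDimensional ℂ (LinearMap.range (A : E →ₗ[ℂ] F))) : IsCompactOperator A := by
  set R := LinearMap.range (A : E →ₗ[ℂ] F)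
  have hid : IsCompactOperator (id : R → R) := isCompactOperator_id_iff_finiteDimensional.2 hA
  exact (hid.comp_clm (A.codRestrict R fun x => ⟨x, rfl⟩)).clm_comp R.subtypeL

/-! ### Attainment by compactness -/

section Attain

variable {E F : Type*} [NormedAddCommGroup E] [InnerProductSpace ℂ E]
  [NormedAddCommGroup F] [InnerProductSpace ℂ F]

theorem isMinimumAttaining_of_finiteDimensional [FiniteDimensional ℂ E] [Nontrivial E]
    (S : E →L[ℂ] F) : IsMinimumAttaining S := by
  have : ProperSpace E := FiniteDimensional.proper ℂ E
  have hne : (Metric.sphere (0 : E) 1).Nonempty := by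
    obtain ⟨x, hx⟩ := exists_norm_eq (E := E) zero_le_one
    exact ⟨x, by simpa using hx⟩
  obtain ⟨x, hx, hmin⟩ := (isCompact_sphere (0 : E) 1).exists_isMinOn hne
    (S.continuous.norm.continuousOn)
  refine isMinimumAttaining_of_le (by simpa using hx) fun y hy => hmin (by simpa using hy)

theorem exists_tendsto_minimumModulus [Nontrivial E] (S : E →L[ℂ] F) :
    ∃ x : ℕ → E, (∀ n, ‖x n‖ = 1) ∧ Tendsto (fun n => ‖S (x n)‖) atTop (𝓝 (minimumModulus S)) := by
  obtain ⟨x₀, hx₀⟩ := exists_norm_eq (E := E) zero_le_one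
  obtain ⟨u, -, hu, hmem⟩ := exists_seq_tendsto_sInf
    (S := {r : ℝ | ∃ x : E, ‖x‖ = 1 ∧ r = ‖S x‖}) ⟨_, x₀, hx₀, rfl⟩
    ⟨0, by rintro _ ⟨x, -, rfl⟩; exact norm_nonneg _⟩
  choose x hx hux using hmem
  exact ⟨x, hx, hu.congr hux⟩

variable [CompleteSpace E] [CompleteSpace F]

/-- If `S† S - a² I` is compact and the minimum modulus is below `a`, it is attained. -/
theorem isMinimumAttaining_of_isCompactOperator_gap [Nontrivial E] {S : E →L[ℂ] F} {a : ℝ}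
    (hS : IsCompactOperator (ContinuousLinearMap.gap S a)) (ha : minimumModulus S < a) :
    IsMinimumAttaining S := by
  set m := minimumModulus S with hm
  have hm0 : 0 ≤ m := minimumModulus_nonneg S
  obtain ⟨x, hx, hlim⟩ := exists_tendsto_minimumModulus S
  rw [← hm] at hlim
  set B := ContinuousLinearMap.gap S m with hB
  have hBpos : B.IsPositive :=
    ContinuousLinearMap.isPositive_gap hm0 (minimumModulus_mul_norm_le S)
  set c : ℝ := a ^ 2 - m ^ 2 with hc
  have hc0 : (c : ℂ) ≠ 0 := by
    have : 0 < c := sub_pos.2 (pow_lt_pow_left₀ ha hm0 two_ne_zero)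
    exact_mod_cast this.ne'
  -- Since `B (x n) → 0`, this recovers convergence of `x n` from convergence of its compact image.
  have hBC : ∀ y, (c : ℂ) • y = B y - ContinuousLinearMap.gap S a y := fun y => by
    simp only [hB, hc, ContinuousLinearMap.gap, sub_apply, smul_apply,
      ContinuousLinearMap.id_apply, Complex.ofReal_sub, sub_smul]
    abel
  have hB0 : Tendsto (fun n => B (x n)) atTop (𝓝 0) := by
    rw [tendsto_zero_iff_norm_tendsto_zero]
    have h1 : Tendsto (fun n => ‖B‖ * (‖S (x n)‖ ^ 2 - m ^ 2)) atTop (𝓝 0) := by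
      have h := ((hlim.pow 2).sub_const (m ^ 2)).const_mul ‖B‖
      rwa [sub_self, mul_zero] at h
    have h2 : Tendsto (fun n => ‖B (x n)‖ ^ 2) atTop (𝓝 0) := by
      refine squeeze_zero (fun n => sq_nonneg _) (fun n => ?_) h1
      have := hBpos.norm_sq_apply_le (x n)
      rwa [ContinuousLinearMap.re_inner_gap_self, hx n, one_pow, mul_one] at this
    simpa [Real.sqrt_sq (norm_nonneg _)] using h2.sqrt
  obtain ⟨K, hK, hsub⟩ := hS.image_closedBall_subset_compact 1
  obtain ⟨y, -, φ, hφ, hy⟩ := hK.tendsto_subseq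
    (x := fun n => ContinuousLinearMap.gap S a (x n))
    (fun n => hsub ⟨x n, by simp [hx n], rfl⟩)
  have hxlim : Tendsto (x ∘ φ) atTop (𝓝 ((c : ℂ)⁻¹ • (0 - y))) := by
    have := ((hB0.comp hφ.tendsto_atTop).sub hy).const_smul (c : ℂ)⁻¹
    refine this.congr fun n => ?_
    simp only [Function.comp_apply]
    rw [← hBC, smul_smul, inv_mul_cancel₀ hc0, one_smul]
  refine ⟨_, tendsto_nhds_unique hxlim.norm ?_,
    tendsto_nhds_unique ((S.continuous.tendsto _).comp hxlim).norm (hlim.comp hφ.tendsto_atTop)⟩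
  simp [hx]

end Attain

/-! ### Consequences of a decomposition -/

section Decomposition

variable {H : Type*} [NormedAddCommGroup H] [InnerProductSpace ℂ H]
  {T : H →L[ℂ] H} {α : ℝ} {K F : H →L[ℂ] H}

namespace IsAMDecomposition

theorem nonneg (h : IsAMDecomposition T α K F) : 0 ≤ α := (norm_nonneg K).trans h.norm_K_le

theorem isCompactOperator_F (h : IsAMDecomposition T α K F) : IsCompactOperator F :=
  isCompactOperator_of_finiteDimensional_range F h.finiteRank_F

theorem isCompactOperator_sub (h : IsAMDecomposition T α K F) :
    IsCompactOperator ((F - K : H →L[ℂ] H)) := h.isCompactOperator_F.sub h.compact_K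

theorem apply_eq (h : IsAMDecomposition T α K F) (x : H) : T x = (α : ℂ) • x + (F - K) x := by
  conv_lhs => rw [h.eq]
  simp only [add_apply, sub_apply, smul_apply, ContinuousLinearMap.id_apply]
  abel

theorem eigenspace_eq_ker (h : IsAMDecomposition T α K F) :
    Module.End.eigenspace (T : H →ₗ[ℂ] H) (α : ℂ) =
      LinearMap.ker ((K - F : H →L[ℂ] H) : H →ₗ[ℂ] H) := by
  ext x
  rw [Module.End.mem_eigenspace_iff, LinearMap.mem_ker]
  simp only [ContinuousLinearMap.coe_coe]
  rw [h.apply_eq, add_eq_left, ← neg_sub, neg_apply, neg_eq_zero]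

end IsAMDecomposition

variable [CompleteSpace H]

theorem ContinuousLinearMap.IsPositive.smul_id_sub (hK : K.IsPositive) (h : ‖K‖ ≤ α) :
    ((α : ℂ) • ContinuousLinearMap.id ℂ H - K).IsPositive := by
  refine (ContinuousLinearMap.isPositive_def').2 ⟨?_, fun x => ?_⟩
  · refine IsSelfAdjoint.sub ?_ hK.isSelfAdjoint
    exact IsSelfAdjoint.smul (by simp [isSelfAdjoint_iff]) (IsSelfAdjoint.one (H →L[ℂ] H))
  · have h1 : (⟪K x, x⟫_ℂ).re ≤ α * ‖x‖ ^ 2 := by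
      calc (⟪K x, x⟫_ℂ).re ≤ ‖⟪K x, x⟫_ℂ‖ := Complex.re_le_norm _
        _ ≤ ‖K x‖ * ‖x‖ := norm_inner_le_norm _ _
        _ ≤ (‖K‖ * ‖x‖) * ‖x‖ := by gcongr; exact K.le_opNorm x
        _ ≤ (α * ‖x‖) * ‖x‖ := by gcongr
        _ = _ := by ring
    change 0 ≤ (⟪((α : ℂ) • ContinuousLinearMap.id ℂ H - K) x, x⟫_ℂ).re
    rw [sub_apply, smul_apply, ContinuousLinearMap.id_apply, inner_sub_left, inner_smul_left,
      inner_self_eq_ofReal_norm_sq, Complex.conj_ofReal, ← Complex.ofReal_mul, Complex.sub_re,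
      Complex.ofReal_re]
    linarith

namespace IsAMDecomposition

theorem isPositive (h : IsAMDecomposition T α K F) : T.IsPositive := by
  rw [h.eq]
  exact (h.positive_K.smul_id_sub h.norm_K_le).add h.positive_F

/-- On `N(F)`, `T` acts as `αI - K`, and `0 ≤ αI - K ≤ αI`. -/
theorem norm_apply_le (h : IsAMDecomposition T α K F) {x : H} (hx : F x = 0) :
    ‖T x‖ ≤ α * ‖x‖ := by
  have h0 := (ContinuousLinearMap.nonneg_iff_isPositive _).2
    (h.positive_K.smul_id_sub h.norm_K_le)
  have h1 : (α : ℂ) • ContinuousLinearMap.id ℂ H - K ≤ (α : ℂ) • ContinuousLinearMap.id ℂ H :=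
    sub_le_self _ ((ContinuousLinearMap.nonneg_iff_isPositive K).2 h.positive_K)
  have h2 := CStarAlgebra.norm_le_norm_of_nonneg_of_le h0 h1
  have h3 : ‖(α : ℂ) • ContinuousLinearMap.id ℂ H‖ ≤ α := by
    rw [norm_smul, Complex.norm_real, Real.norm_of_nonneg h.nonneg]
    exact mul_le_of_le_one_right h.nonneg ContinuousLinearMap.norm_id_le
  have h4 : T x = ((α : ℂ) • ContinuousLinearMap.id ℂ H - K) x := by
    conv_lhs => rw [h.eq]
    simp [hx]
  rw [h4]
  exact ContinuousLinearMap.le_of_opNorm_le _ (h2.trans h3) x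

/-- With `J` the inclusion of `M`, the gap is `J† (T² - α²) J = J† (T + α)(F - K) J`, which has a
compact factor. -/
theorem isCompactOperator_gap (h : IsAMDecomposition T α K F) (M : Submodule ℂ H)
    [CompleteSpace M] : IsCompactOperator (ContinuousLinearMap.gap (T.comp M.subtypeL) α) := by
  have h1 : IsCompactOperator
      ((ContinuousLinearMap.adjoint M.subtypeL) ∘
        ((T + (α : ℂ) • ContinuousLinearMap.id ℂ H : H →L[ℂ] H) ∘ ((F - K : H →L[ℂ] H) ∘
          M.subtypeL))) :=
    ((h.isCompactOperator_sub.comp_clm M.subtypeL).clm_comp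
      (T + (α : ℂ) • ContinuousLinearMap.id ℂ H)).clm_comp (ContinuousLinearMap.adjoint M.subtypeL)
  convert h1 using 1
  ext1 x
  refine ext_inner_right ℂ fun y => ?_
  rw [ContinuousLinearMap.inner_gap]
  have hsa : ⟪T x, T y⟫_ℂ = ⟪T (T x), y⟫_ℂ := (h.isPositive.inner_left_eq_inner_right _ _).symm
  have hFK : (F - K) (x : H) = T x - (α : ℂ) • (x : H) := by rw [h.apply_eq]; abel
  simp only [Function.comp_apply, ContinuousLinearMap.adjoint_inner_left,
    ContinuousLinearMap.comp_apply, Submodule.subtypeL_apply, hFK, add_apply, smul_apply,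
    ContinuousLinearMap.id_apply, map_sub, map_smul, hsa, inner_add_left, inner_sub_left,
    inner_smul_left, Complex.conj_ofReal, Submodule.coe_inner]
  push_cast
  ring

theorem isAbsolutelyMinimumAttaining (h : IsAMDecomposition T α K F) :
    IsAbsolutelyMinimumAttaining T := by
  intro M hM hM0
  have : CompleteSpace M := hM.completeSpace_coe
  have : Nontrivial M := Submodule.nontrivial_iff_ne_bot.2 hM0
  set S := T.comp M.subtypeL with hS
  rcases lt_or_ge (minimumModulus S) α with hlt | hge
  · exact isMinimumAttaining_of_isCompactOperator_gap (h.isCompactOperator_gap M) hlt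
  by_cases hker : ∃ x ∈ M, x ≠ 0 ∧ F x = 0
  · obtain ⟨x, hxM, hx0, hFx⟩ := hker
    have hu := norm_smul_inv_norm (𝕜 := ℂ) hx0
    set u : M := ⟨((‖x‖ : ℂ)⁻¹) • x, M.smul_mem _ hxM⟩
    have hu1 : ‖u‖ = 1 := hu
    refine ⟨u, hu1, le_antisymm ?_ (minimumModulus_le S hu1)⟩
    have h1 : ‖S u‖ ≤ α * ‖u‖ := h.norm_apply_le (x := (u : H)) (by simp [u, hFx])
    rw [hu1, mul_one] at h1
    exact h1.trans hge
  · push Not at hker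
    have hfin := h.finiteRank_F
    have : FiniteDimensional ℂ M := by
      refine FiniteDimensional.of_injective
        ((F : H →ₗ[ℂ] H).rangeRestrict.comp M.subtype) ?_
      refine (injective_iff_map_eq_zero _).2 fun x hx => ?_
      by_contra hx0
      exact hker x x.2 (by simpa using hx0) (congrArg Subtype.val hx)
    exact isMinimumAttaining_of_finiteDimensional S

theorem isPositiveAM (h : IsAMDecomposition T α K F) : IsPositiveAM T :=
  ⟨h.isAbsolutelyMinimumAttaining, h.isPositive⟩

theorem eq_of_not_finiteDimensional (hH : ¬ FiniteDimensional ℂ H)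
    (h : IsAMDecomposition T α K F) {α' : ℝ} {K' F' : H →L[ℂ] H}
    (h' : IsAMDecomposition T α' K' F') : α = α' ∧ K = K' ∧ F = F' := by
  have hα : α = α' := by
    by_contra hne
    have hne' : ((α : ℂ) - α') ≠ 0 := by
      rw [sub_ne_zero]; exact_mod_cast hne
    refine hH (FiniteDimensional.of_isCompactOperator_id ?_)
    -- This compact operator is the identity.
    have hc := ((h'.isCompactOperator_sub.sub h.isCompactOperator_sub)).smul ((α : ℂ) - α')⁻¹
    refine (congrArg IsCompactOperator (funext fun x => ?_)).mp hc
    have h1 := h.apply_eq x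
    rw [h'.apply_eq x] at h1
    have h2 : (F' - K') x - (F - K) x = ((α : ℂ) - α') • x := by
      rw [sub_smul, sub_eq_sub_iff_add_eq_add, add_comm, h1]
    simp only [Pi.smul_apply, Pi.sub_apply, id]
    rw [h2, smul_smul, inv_mul_cancel₀ hne', one_smul]
  subst hα
  have hFK : F - K = F' - K' := by
    ext x
    have h1 := h.apply_eq x
    rw [h'.apply_eq x] at h1
    exact (add_left_cancel h1).symm
  -- Positivity and `F K = 0` identify `F` and `K` with the positive and negative parts of `F - K`.
  have e := CFC.posPart_negPart_unique (A := H →L[ℂ] H) rfl h.comp_FK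
    ((ContinuousLinearMap.nonneg_iff_isPositive _).2 h.positive_F)
    ((ContinuousLinearMap.nonneg_iff_isPositive _).2 h.positive_K)
  have e' := CFC.posPart_negPart_unique (A := H →L[ℂ] H) hFK h'.comp_FK
    ((ContinuousLinearMap.nonneg_iff_isPositive _).2 h'.positive_F)
    ((ContinuousLinearMap.nonneg_iff_isPositive _).2 h'.positive_K)
  exact ⟨rfl, e.2.symm.trans e'.2, e.1.symm.trans e'.1⟩

theorem finiteDimensional_eigenspace (h : IsAMDecomposition T α K F) {μ : ℂ} (hμ : μ ≠ α) :
    FiniteDimensional ℂ (Module.End.eigenspace (T : H →ₗ[ℂ] H) μ) := by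
  have := ContinuousLinearMap.finite_dimensional_eigenspace h.isCompactOperator_sub (μ - α)
    (sub_ne_zero.2 hμ)
  suffices hE : Module.End.eigenspace (T : H →ₗ[ℂ] H) μ =
      Module.End.eigenspace ((F - K : H →L[ℂ] H) : H →ₗ[ℂ] H) (μ - α) by rwa [hE]
  ext x
  rw [Module.End.mem_eigenspace_iff, Module.End.mem_eigenspace_iff]
  simp only [ContinuousLinearMap.coe_coe]
  rw [h.apply_eq, sub_smul, eq_sub_iff_add_eq, add_comm]

theorem isEigenvalueOfInfiniteMultiplicity_iff (h : IsAMDecomposition T α K F) (μ : ℂ) :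
    IsEigenvalueOfInfiniteMultiplicity T μ ↔ μ = α ∧
      ¬ FiniteDimensional ℂ (LinearMap.ker ((K - F : H →L[ℂ] H) : H →ₗ[ℂ] H)) := by
  rw [← h.eigenspace_eq_ker]
  constructor
  · rintro ⟨-, hinf⟩
    have hμ : μ = α := by
      by_contra hne
      exact hinf (h.finiteDimensional_eigenspace hne)
    exact ⟨hμ, hμ ▸ hinf⟩
  · rintro ⟨rfl, hinf⟩
    refine ⟨fun hbot => hinf ?_, hinf⟩
    change Module.End.eigenspace _ _ = ⊥ at hbot
    rw [hbot]
    infer_instance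

theorem isFirstType_iff (h : IsAMDecomposition T α K F) :
    IsFirstType T ↔
      FiniteDimensional ℂ (LinearMap.ker ((K - F : H →L[ℂ] H) : H →ₗ[ℂ] H)) := by
  simp only [IsFirstType, h.isPositiveAM, true_and, h.isEigenvalueOfInfiniteMultiplicity_iff,
    exists_eq_left, not_not]

theorem isSecondType_iff (h : IsAMDecomposition T α K F) :
    IsSecondType T ↔
      ¬ FiniteDimensional ℂ (LinearMap.ker ((K - F : H →L[ℂ] H) : H →ₗ[ℂ] H)) := by
  simp only [IsSecondType, h.isPositiveAM, true_and, h.isEigenvalueOfInfiniteMultiplicity_iff]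
  exact ⟨fun ⟨_, hμ, _⟩ => hμ.2, fun hinf => ⟨α, ⟨rfl, hinf⟩, fun _ hμ => hμ.1⟩⟩

end IsAMDecomposition

end Decomposition

/-! ### Diagonalisation and the distribution of eigenvalues -/

section Eigenbasis

section

variable {ι H : Type*} [NormedAddCommGroup H] [InnerProductSpace ℂ H]

theorem HilbertBasis.inner_eq_zero (b : HilbertBasis ι ℂ H) {i j : ι} (h : i ≠ j) :
    ⟪b i, b j⟫_ℂ = 0 := b.orthonormal.2 h

theorem HilbertBasis.norm_sq_add (b : HilbertBasis ι ℂ H) {i j : ι} (h : i ≠ j) (r s : ℝ) :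
    ‖(r : ℂ) • b i + (s : ℂ) • b j‖ ^ 2 = r ^ 2 + s ^ 2 := by
  have := norm_add_sq_eq_norm_sq_add_norm_sq_of_inner_eq_zero ((r : ℂ) • b i) ((s : ℂ) • b j)
    (𝕜 := ℂ) (by rw [inner_smul_left, inner_smul_right, b.inner_eq_zero h]; simp)
  rw [sq, this]
  simp [norm_smul, b.orthonormal.1, sq]

end

variable {H : Type*} [NormedAddCommGroup H] [InnerProductSpace ℂ H] [CompleteSpace H]
  {T : H →L[ℂ] H}

/-- On a closed invariant subspace the minimum modulus of a positive absolutely minimum attaining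
operator is an eigenvalue. -/
theorem IsPositiveAM.exists_eigenvector (hT : IsPositiveAM T) {M : Submodule ℂ H}
    (hM : IsClosed (M : Set H)) (hM0 : M ≠ ⊥) (hinv : ∀ x ∈ M, T x ∈ M) :
    ∃ m : ℝ, 0 ≤ m ∧ (∀ y ∈ M, m * ‖y‖ ≤ ‖T y‖) ∧ ∃ x ∈ M, ‖x‖ = 1 ∧ T x = (m : ℂ) • x := by
  obtain ⟨m, hm, hle, x, hxM, hx, hTx, hvar⟩ := hT.1.exists_minimizer hM hM0
  refine ⟨m, hm, hle, x, hxM, hx, ?_⟩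
  have hTT : T (T x) = ((m ^ 2 : ℝ) : ℂ) • x := by
    have horth : ∀ y ∈ M, ⟪T (T x) - ((m ^ 2 : ℝ) : ℂ) • x, y⟫_ℂ = 0 := fun y hy => by
      rw [inner_sub_left, inner_smul_left, Complex.conj_ofReal, hT.2.inner_left_eq_inner_right,
        hvar y hy, sub_self]
    exact sub_eq_zero.1 (inner_self_eq_zero.1 (horth _
      (M.sub_mem (hinv _ (hinv _ hxM)) (M.smul_mem _ hxM))))
  rcases hm.eq_or_lt with rfl | hpos
  · simpa using hTx
  set z := T x - (m : ℂ) • x with hz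
  -- From `(T + m)(T - m) x = 0`; a positive `T` has no eigenvalue `-m < 0`, so `z = 0`.
  have hTz : T z = -((m : ℂ) • z) := by
    rw [hz, map_sub, map_smul, hTT, smul_sub, smul_smul, neg_sub, Complex.ofReal_pow, sq]
  have hnn := hT.2.re_inner_nonneg_left z
  rw [hTz, inner_neg_left, inner_smul_left, inner_self_eq_ofReal_norm_sq, Complex.conj_ofReal,
    ← Complex.ofReal_mul, ← Complex.ofReal_neg] at hnn
  have hnn' : 0 ≤ -(m * ‖z‖ ^ 2) := hnn
  have hz0 : ‖z‖ ^ 2 = 0 := by nlinarith [sq_nonneg ‖z‖]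
  exact sub_eq_zero.1 (norm_eq_zero.1 (pow_eq_zero_iff two_ne_zero |>.1 hz0))

/-- The orthogonal complement of a set of eigenvectors is closed and invariant, so if nonzero it
supplies another eigenvector; a maximal orthonormal set of eigenvectors is therefore total. -/
theorem IsPositiveAM.exists_hilbertBasis (hT : IsPositiveAM T) :
    ∃ (v : Set H) (b : HilbertBasis v ℂ H) (l : v → ℝ),
      (∀ i, 0 ≤ l i) ∧ ∀ i, T (b i) = (l i : ℂ) • b i := by
  obtain ⟨v, hv⟩ := zorn_subset {v : Set H | Orthonormal ℂ ((↑) : v → H) ∧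
      ∀ x ∈ v, ∃ l : ℝ, 0 ≤ l ∧ T x = (l : ℂ) • x} (fun c hc hchain =>
    ⟨⋃₀ c, ⟨orthonormal_sUnion_of_directed hchain.directedOn fun a ha => (hc ha).1,
      fun x ⟨a, ha, hxa⟩ => (hc ha).2 x hxa⟩, fun a ha => Set.subset_sUnion_of_mem ha⟩)
  obtain ⟨⟨hvo, hve⟩, hmax⟩ := hv
  have hbot : (Submodule.span ℂ v)ᗮ = ⊥ := by
    by_contra hne
    have hspan : ∀ x ∈ Submodule.span ℂ v, T x ∈ Submodule.span ℂ v := by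
      have : Submodule.span ℂ v ≤ (Submodule.span ℂ v).comap (T : H →ₗ[ℂ] H) := by
        refine Submodule.span_le.2 fun x hx => ?_
        obtain ⟨l, -, hl⟩ := hve x hx
        change T x ∈ Submodule.span ℂ v
        rw [hl]
        exact Submodule.smul_mem _ _ (Submodule.subset_span hx)
      exact this
    obtain ⟨m, hm, -, e, he, he1, hTe⟩ := hT.exists_eigenvector
      (Submodule.isClosed_orthogonal (Submodule.span ℂ v)) hne fun x hx y hy => by
        rw [← hT.2.inner_left_eq_inner_right]
        exact hx _ (hspan y hy)
    have hev : ∀ a ∈ v, ⟪a, e⟫_ℂ = 0 := fun a ha => he a (Submodule.subset_span ha)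
    have hmem : e ∈ v := by
      refine hmax ⟨⟨?_, ?_⟩, ?_⟩ (Set.subset_insert e v) (Set.mem_insert e v)
      · rintro ⟨a, rfl | ha⟩
        · exact he1
        · exact hvo.1 ⟨a, ha⟩
      · rintro ⟨a, rfl | ha⟩ ⟨c, rfl | hc⟩ hac
        · exact absurd rfl hac
        · exact inner_eq_zero_symm.1 (hev c hc)
        · exact hev a ha
        · exact hvo.2 (i := ⟨a, ha⟩) (j := ⟨c, hc⟩) fun h => hac (Subtype.ext (Subtype.mk.inj h))
      · rintro a (rfl | ha)
        · exact ⟨m, hm, hTe⟩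
        · exact hve a ha
    have := hev e hmem
    rw [inner_self_eq_zero] at this
    simp [this] at he1
  choose l hl0 hl using fun i : v => hve i i.2
  refine ⟨v, HilbertBasis.mkOfOrthogonalEqBot hvo (by simpa using hbot), l, hl0, fun i => ?_⟩
  simpa using hl i

variable {ι : Type*} {b : HilbertBasis ι ℂ H} {l : ι → ℝ}

/-- The eigenvalues of a diagonal absolutely minimum attaining operator cannot have infinitely many
indices on both sides of a gap. -/
theorem IsAbsolutelyMinimumAttaining.finite_or_finite (hT : IsAbsolutelyMinimumAttaining T)
    (hl0 : ∀ i, 0 ≤ l i) (hl : ∀ i, T (b i) = (l i : ℂ) • b i) {a c : ℝ} (hac : a < c) :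
    {i | l i ≤ a}.Finite ∨ {i | c ≤ l i}.Finite := by
  by_contra hinf
  push Not at hinf
  obtain ⟨hA, hC⟩ := hinf
  set p : ℕ → ι := fun n => hA.natEmbedding _ n with hp
  set q : ℕ → ι := fun n => hC.natEmbedding _ n with hq
  have hpa : ∀ n, l (p n) ≤ a := fun n => (hA.natEmbedding _ n).2
  have hqc : ∀ n, c ≤ l (q n) := fun n => (hC.natEmbedding _ n).2
  have hpi : Function.Injective p := Subtype.val_injective.comp (hA.natEmbedding _).injective
  have hqi : Function.Injective q := Subtype.val_injective.comp (hC.natEmbedding _).injective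
  have hpq : ∀ n k, p n ≠ q k := fun n k h => by
    have h1 := hpa n
    rw [h] at h1
    exact absurd (hac.trans_le (hqc k)) h1.not_gt
  have ha0 : 0 ≤ a := (hl0 _).trans (hpa 0)
  have hd : 0 < c ^ 2 - a ^ 2 := sub_pos.2 (pow_lt_pow_left₀ hac ha0 two_ne_zero)
  -- Target ratios decreasing strictly inside `(a², c²)`; the shift by 2 keeps `t 0` below `c²`.
  set t : ℕ → ℝ := fun n => a ^ 2 + (c ^ 2 - a ^ 2) / (n + 2) with ht
  have hta : ∀ n, a ^ 2 < t n := fun n => lt_add_of_pos_right _ (by positivity)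
  have htc : ∀ n, t n < c ^ 2 := fun n => by
    have : (c ^ 2 - a ^ 2) / ((n : ℝ) + 2) < c ^ 2 - a ^ 2 :=
      div_lt_self hd (by have : (0 : ℝ) ≤ n := n.cast_nonneg; linarith)
    simp only [ht]
    linarith
  have htanti : StrictAnti t := strictAnti_nat_of_succ_lt fun n => by
    simp only [ht]
    gcongr
    simp
  have hpt : ∀ n, 0 < t n - l (p n) ^ 2 := fun n =>
    sub_pos.2 ((pow_le_pow_left₀ (hl0 _) (hpa n) 2).trans_lt (hta n))
  have hqt : ∀ n, 0 < l (q n) ^ 2 - t n := fun n =>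
    sub_pos.2 ((htc n).trans_le (pow_le_pow_left₀ (ha0.trans hac.le) (hqc n) 2))
  -- The weight solving `l (p n)² + r² l (q n)² = t n (1 + r²)`, so that `b (p n) + r n b (q n)` has
  -- ratio `t n`.
  set r : ℕ → ℝ := fun n => √((t n - l (p n) ^ 2) / (l (q n) ^ 2 - t n)) with hr
  have hr2 : ∀ n, r n ^ 2 * (l (q n) ^ 2 - t n) = t n - l (p n) ^ 2 := fun n => by
    simp only [hr]
    rw [Real.sq_sqrt (div_nonneg (hpt n).le (hqt n).le), div_mul_cancel₀ _ (hqt n).ne']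
  have horth : ∀ (x y : ℕ → ℂ) (n k : ℕ), n ≠ k →
      ⟪x n • b (p n) + y n • b (q n), x k • b (p k) + y k • b (q k)⟫_ℂ = 0 := by
    intro x y n k hnk
    simp [b.inner_eq_zero (hpi.ne hnk), b.inner_eq_zero (hqi.ne hnk), b.inner_eq_zero (hpq n k),
      b.inner_eq_zero (hpq k n).symm]
  have hf2 : ∀ n, ‖((1 : ℝ) : ℂ) • b (p n) + (r n : ℂ) • b (q n)‖ ^ 2 = 1 + r n ^ 2 := fun n => by
    rw [b.norm_sq_add (hpq n n), one_pow]
  have hTf : ∀ n, T (((1 : ℝ) : ℂ) • b (p n) + (r n : ℂ) • b (q n)) =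
      ((l (p n) : ℝ) : ℂ) • b (p n) + ((r n * l (q n) : ℝ) : ℂ) • b (q n) := fun n => by
    simp only [map_add, map_smul, hl, smul_smul, Complex.ofReal_mul, Complex.ofReal_one, one_mul]
  refine hT.not_strictAnti (f := fun n => ((1 : ℝ) : ℂ) • b (p n) + (r n : ℂ) • b (q n)) (t := t)
    (fun n h0 => ?_) (fun n k hnk =>
      horth (fun _ => ((1 : ℝ) : ℂ)) (fun n => (r n : ℂ)) n k hnk) (fun n k hnk => ?_) (fun n => ?_) htanti
  · have := hf2 n
    rw [h0] at this
    nlinarith [sq_nonneg (r n), norm_zero (E := H)]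
  · simp only [hTf]
    exact horth (fun n => (l (p n) : ℂ)) (fun n => ((r n * l (q n) : ℝ) : ℂ)) n k hnk
  · simp only [hTf]
    rw [b.norm_sq_add (hpq n n), hf2]
    linear_combination hr2 n

/-- The minimum of `T` on the closed span of the `b i` with `l i > a` is itself one of these
eigenvalues. So they are bounded below by some `m > a`, and `ha` applies at `m`. -/
theorem IsPositiveAM.finite_setOf_lt (hT : IsPositiveAM T)
    (hl : ∀ i, T (b i) = (l i : ℂ) • b i) {a : ℝ} (ha : ∀ c, a < c → {i | c ≤ l i}.Finite)
    (hl0 : ∀ i, 0 ≤ l i) : {i | a < l i}.Finite := by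
  rcases Set.eq_empty_or_nonempty {i | a < l i} with h0 | ⟨i₀, hi₀⟩
  · simp [h0]
  set J := {i | a < l i} with hJ
  set N := Submodule.span ℂ (b '' J) with hN
  have hbN : ∀ i ∈ J, b i ∈ N.topologicalClosure := fun i hi =>
    N.le_topologicalClosure (Submodule.subset_span ⟨i, hi, rfl⟩)
  have hinv : ∀ x ∈ N.topologicalClosure, T x ∈ N.topologicalClosure := by
    have : N.topologicalClosure ≤ N.topologicalClosure.comap (T : H →ₗ[ℂ] H) := by
      refine Submodule.topologicalClosure_minimal _ (Submodule.span_le.2 ?_)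
        (N.isClosed_topologicalClosure.preimage T.continuous)
      rintro _ ⟨i, hi, rfl⟩
      change T (b i) ∈ N.topologicalClosure
      rw [hl]
      exact Submodule.smul_mem _ _ (hbN i hi)
    exact this
  obtain ⟨m, hm, hle, x, hxM, hx, hTx⟩ := hT.exists_eigenvector N.isClosed_topologicalClosure
    (fun h => b.orthonormal.ne_zero i₀ (by simpa [h] using hbN i₀ hi₀)) hinv
  have hml : ∀ i ∈ J, m ≤ l i := fun i hi => by
    have := hle _ (hbN i hi)
    rw [hl, norm_smul, b.orthonormal.1 i] at this
    simpa [abs_of_nonneg (hl0 i)] using this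
  obtain ⟨i, hi, hix⟩ : ∃ i ∈ J, ⟪x, b i⟫_ℂ ≠ 0 := by
    by_contra! hall
    have hle : N.topologicalClosure ≤ LinearMap.ker (innerSL ℂ x : H →ₗ[ℂ] ℂ) := by
      refine Submodule.topologicalClosure_minimal _ (Submodule.span_le.2 ?_)
        (innerSL ℂ x).isClosed_ker
      rintro _ ⟨i, hi, rfl⟩
      exact hall i hi
    have h0 : ⟪x, x⟫_ℂ = 0 := hle hxM
    rw [inner_self_eq_zero] at h0
    simp [h0] at hx
  have hmi : m = l i := by
    have h1 := hT.2.inner_left_eq_inner_right x (b i)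
    rw [hTx, hl, inner_smul_left, inner_smul_right, Complex.conj_ofReal] at h1
    exact_mod_cast mul_right_cancel₀ hix h1
  exact (ha m (hmi ▸ hi)).subset hml

/-- The eigenvalues of a positive absolutely minimum attaining operator accumulate only at one
point, and only finitely many of them exceed it. -/
theorem IsPositiveAM.exists_limit [Infinite ι] (hT : IsPositiveAM T) (hl0 : ∀ i, 0 ≤ l i)
    (hl : ∀ i, T (b i) = (l i : ℂ) • b i) :
    ∃ α : ℝ, 0 ≤ α ∧ {i | α < l i}.Finite ∧ ∀ c < α, {i | l i ≤ c}.Finite := by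
  have hbd : ∀ i, l i ≤ ‖T‖ := fun i => by
    have := T.le_opNorm (b i)
    rw [hl, norm_smul, b.orthonormal.1 i] at this
    simpa [abs_of_nonneg (hl0 i)] using this
  -- The limit point is the infimum of the levels with infinitely many eigenvalues, counted with
  -- multiplicity, at or below them.
  set C : Set ℝ := {c | {i | l i ≤ c}.Infinite} with hC
  have hCne : C.Nonempty := ⟨‖T‖, by simpa [hC, hbd] using Set.infinite_univ⟩
  have hC0 : ∀ c ∈ C, 0 ≤ c := fun c hc => by
    obtain ⟨i, hi⟩ := Set.Infinite.nonempty hc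
    exact (hl0 i).trans hi
  refine ⟨sInf C, le_csInf hCne hC0, hT.finite_setOf_lt hl (fun c hc => ?_) hl0, fun c hc => ?_⟩
  · obtain ⟨c', hc', hlt⟩ := exists_lt_of_csInf_lt hCne hc
    exact (hT.1.finite_or_finite hl0 hl hlt).resolve_left hc'
  · by_contra hinf
    exact absurd (csInf_le ⟨0, hC0⟩ hinf) hc.not_ge

end Eigenbasis

/-! ### Operators diagonal in a Hilbert basis -/

section Diagonal

variable {ι H : Type*} [NormedAddCommGroup H] [InnerProductSpace ℂ H]
  {b : HilbertBasis ι ℂ H} {A : H →L[ℂ] H} {d : ι → ℝ}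

theorem HilbertBasis.ext_clm (b : HilbertBasis ι ℂ H) {F : Type*} [NormedAddCommGroup F]
    [NormedSpace ℂ F] {A B : H →L[ℂ] F} (h : ∀ i, A (b i) = B (b i)) : A = B := by
  refine ContinuousLinearMap.ext_on
    ((Submodule.dense_iff_topologicalClosure_eq_top).2 b.dense_span) ?_
  rintro _ ⟨i, rfl⟩
  exact h i

theorem HilbertBasis.hasSum_norm_sq (b : HilbertBasis ι ℂ H) (x : H) :
    HasSum (fun i => ‖⟪b i, x⟫_ℂ‖ ^ 2) (‖x‖ ^ 2) := by
  have h := Complex.hasSum_re (b.hasSum_inner_mul_inner x x)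
  rw [inner_self_eq_ofReal_norm_sq, Complex.ofReal_re] at h
  refine h.congr_fun fun i => ?_
  rw [← inner_conj_symm x, Complex.conj_mul', ← Complex.ofReal_pow, Complex.ofReal_re]

theorem HilbertBasis.inner_diagonal_apply (hA : ∀ i, A (b i) = (d i : ℂ) • b i) (i : ι) (x : H) :
    ⟪b i, A x⟫_ℂ = (d i : ℂ) * ⟪b i, x⟫_ℂ := by
  have : (innerSL ℂ (b i)).comp A = (d i : ℂ) • innerSL ℂ (b i) := by
    refine b.ext_clm fun j => ?_
    simp only [ContinuousLinearMap.comp_apply, innerSL_apply_apply, smul_apply, hA,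
      inner_smul_right, smul_eq_mul]
    rcases eq_or_ne i j with rfl | hij
    · rfl
    · simp [b.inner_eq_zero hij]
  exact congrArg (fun g : H →L[ℂ] ℂ => g x) this

theorem HilbertBasis.isPositive_of_diagonal (hA : ∀ i, A (b i) = (d i : ℂ) • b i)
    (hd : ∀ i, 0 ≤ d i) : A.IsPositive := by
  have hconj : ∀ (i : ι) (x : H), ⟪A x, b i⟫_ℂ = (d i : ℂ) * ⟪x, b i⟫_ℂ := fun i x => by
    rw [← inner_conj_symm, b.inner_diagonal_apply hA, map_mul, inner_conj_symm,
      Complex.conj_ofReal]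
  refine (ContinuousLinearMap.isPositive_def).2 ⟨fun x y => ?_, fun x => ?_⟩
  · change ⟪A x, y⟫_ℂ = ⟪x, A y⟫_ℂ
    rw [← b.tsum_inner_mul_inner, ← b.tsum_inner_mul_inner x]
    refine tsum_congr fun i => ?_
    rw [hconj, b.inner_diagonal_apply hA]
    ring
  · change 0 ≤ (⟪A x, x⟫_ℂ).re
    refine (Complex.hasSum_re (b.hasSum_inner_mul_inner (A x) x)).nonneg fun i => ?_
    rw [hconj, mul_assoc, ← inner_conj_symm x, Complex.conj_mul', ← Complex.ofReal_pow,
      ← Complex.ofReal_mul, Complex.ofReal_re]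
    exact mul_nonneg (hd i) (sq_nonneg _)

theorem HilbertBasis.norm_le_of_diagonal (hA : ∀ i, A (b i) = (d i : ℂ) • b i) {c : ℝ}
    (hc : 0 ≤ c) (hd : ∀ i, |d i| ≤ c) : ‖A‖ ≤ c := by
  refine A.opNorm_le_bound hc fun x => ?_
  refine le_of_sq_le_sq ?_ (by positivity)
  rw [mul_pow]
  refine hasSum_le (fun i => ?_) (b.hasSum_norm_sq (A x)) ((b.hasSum_norm_sq x).mul_left (c ^ 2))
  rw [b.inner_diagonal_apply hA, norm_mul, mul_pow, Complex.norm_real, Real.norm_eq_abs]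
  have := hd i
  gcongr

/-- The finite rank operator `x ↦ ∑ i ∈ s, d i ⟪b i, x⟫ b i`. -/
noncomputable def HilbertBasis.finiteDiagonal (b : HilbertBasis ι ℂ H) (s : Finset ι) (d : ι → ℝ) :
    H →L[ℂ] H :=
  ∑ i ∈ s, (d i : ℂ) • InnerProductSpace.rankOne ℂ (b i) (b i)

theorem HilbertBasis.finiteDiagonal_apply (b : HilbertBasis ι ℂ H) (s : Finset ι) (d : ι → ℝ)
    (x : H) : b.finiteDiagonal s d x = ∑ i ∈ s, (d i : ℂ) • ⟪b i, x⟫_ℂ • b i := by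
  simp [finiteDiagonal]

open scoped Classical in
theorem HilbertBasis.finiteDiagonal_apply_self (b : HilbertBasis ι ℂ H) (s : Finset ι) (d : ι → ℝ)
    (j : ι) : b.finiteDiagonal s d (b j) = ((if j ∈ s then d j else 0 : ℝ) : ℂ) • b j := by
  rw [finiteDiagonal_apply]
  have h0 : ∀ i ∈ s, i ≠ j → (d i : ℂ) • ⟪b i, b j⟫_ℂ • b i = 0 := fun i _ hij => by
    rw [b.inner_eq_zero hij, zero_smul, smul_zero]
  by_cases hj : j ∈ s
  · rw [Finset.sum_eq_single_of_mem j hj h0, if_pos hj, inner_self_eq_ofReal_norm_sq,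
      b.orthonormal.1 j]
    simp
  · rw [Finset.sum_eq_zero fun i hi => h0 i hi (ne_of_mem_of_not_mem hi hj), if_neg hj]
    simp

theorem HilbertBasis.finiteDimensional_range_finiteDiagonal (b : HilbertBasis ι ℂ H)
    (s : Finset ι) (d : ι → ℝ) :
    FiniteDimensional ℂ (LinearMap.range (b.finiteDiagonal s d : H →ₗ[ℂ] H)) := by
  have : FiniteDimensional ℂ (Submodule.span ℂ (b '' s)) :=
    FiniteDimensional.span_of_finite ℂ (s.finite_toSet.image b)
  refine Submodule.finiteDimensional_of_le (S₂ := Submodule.span ℂ (b '' s)) ?_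
  rintro _ ⟨x, rfl⟩
  rw [ContinuousLinearMap.coe_coe, finiteDiagonal_apply]
  exact Submodule.sum_mem _ fun i hi => Submodule.smul_mem _ _ <| Submodule.smul_mem _ _ <|
    Submodule.subset_span ⟨i, hi, rfl⟩

/-- Truncating to the finitely many entries of size at least `ε / 2` approximates `A` in norm by
finite rank operators, and compact operators are norm closed. -/
theorem HilbertBasis.isCompactOperator_of_diagonal [CompleteSpace H]
    (hA : ∀ i, A (b i) = (d i : ℂ) • b i) (hd : ∀ ε > 0, {i | ε ≤ |d i|}.Finite) :
    IsCompactOperator A := by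
  classical
  have hcl : A ∈ closure {B : H →L[ℂ] H | IsCompactOperator B} := by
    refine Metric.mem_closure_iff.2 fun ε hε => ?_
    refine ⟨b.finiteDiagonal (hd (ε / 2) (by positivity)).toFinset d,
      isCompactOperator_of_finiteDimensional_range _
        (b.finiteDimensional_range_finiteDiagonal _ d), ?_⟩
    rw [dist_eq_norm]
    refine (b.norm_le_of_diagonal (d := fun i => if ε / 2 ≤ |d i| then 0 else d i)
      (fun i => ?_) (by positivity : 0 ≤ ε / 2) fun i => ?_).trans_lt (half_lt_self hε)
    · rw [sub_apply, hA, finiteDiagonal_apply_self, ← sub_smul]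
      simp only [Set.Finite.mem_toFinset, Set.mem_ofPred_eq]
      split_ifs <;> simp
    · split_ifs with h
      · simpa using by positivity
      · exact (not_le.1 h).le
  rwa [isClosed_setOfPred_isCompactOperator.closure_eq] at hcl

theorem HilbertBasis.infinite {ι : Type*} (b : HilbertBasis ι ℂ H)
    (hH : ¬ FiniteDimensional ℂ H) : Infinite ι := by
  by_contra hfin
  have := not_infinite_iff_finite.1 hfin
  have := Fintype.ofFinite ι
  exact hH (Module.Basis.finiteDimensional_of_finite b.toOrthonormalBasis.toBasis)

end Diagonal

/-! ### Construction of the decomposition -/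

section Existence

variable {H : Type*} [NormedAddCommGroup H] [InnerProductSpace ℂ H] [CompleteSpace H]
  {T : H →L[ℂ] H}

theorem IsPositiveAM.exists_isAMDecomposition (hH : ¬ FiniteDimensional ℂ H)
    (hT : IsPositiveAM T) : ∃ (α : ℝ) (K F : H →L[ℂ] H), IsAMDecomposition T α K F := by
  classical
  obtain ⟨v, b, l, hl0, hl⟩ := hT.exists_hilbertBasis
  have := b.infinite hH
  obtain ⟨α, hα, hfin, hlow⟩ := hT.exists_limit hl0 hl
  set F := b.finiteDiagonal hfin.toFinset (fun i => l i - α) with hFdef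
  have hF : ∀ i, F (b i) = ((if α < l i then l i - α else 0 : ℝ) : ℂ) • b i := fun i => by
    rw [hFdef, b.finiteDiagonal_apply_self]
    simp only [Set.Finite.mem_toFinset, Set.mem_ofPred_eq]
  -- Defined so that the required identity is automatic; its diagonal entries are the negative parts
  -- of `l i - α`.
  set K := (α : ℂ) • ContinuousLinearMap.id ℂ H - T + F with hKdef
  have hK : ∀ i, K (b i) = ((if α < l i then 0 else α - l i : ℝ) : ℂ) • b i := fun i => by
    rw [hKdef, add_apply, sub_apply, smul_apply, ContinuousLinearMap.id_apply, hl, hF, ← sub_smul,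
      ← add_smul]
    congr 1
    split_ifs <;> push_cast <;> ring
  have hK0 : ∀ i, 0 ≤ (if α < l i then 0 else α - l i) := fun i => by
    split_ifs with h
    · exact le_rfl
    · linarith
  refine ⟨α, K, F, ?_, b.isPositive_of_diagonal hK hK0,
    b.isCompactOperator_of_diagonal hK fun ε hε => (hlow (α - ε) (by linarith)).subset ?_,
    b.norm_le_of_diagonal hK hα fun i => ?_, b.isPositive_of_diagonal hF fun i => ?_,
    b.finiteDimensional_range_finiteDiagonal _ _, b.ext_clm fun i => ?_, b.ext_clm fun i => ?_⟩
  · rw [hKdef]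
    abel
  · intro i hi
    rw [Set.mem_ofPred_eq, abs_of_nonneg (hK0 i)] at hi
    rw [Set.mem_ofPred_eq]
    split_ifs at hi <;> linarith
  · rw [abs_of_nonneg (hK0 i)]
    have := hl0 i
    split_ifs <;> linarith
  · split_ifs <;> linarith
  · rw [ContinuousLinearMap.comp_apply, hF, map_smul, hK, smul_smul]
    split_ifs <;> simp
  · rw [ContinuousLinearMap.comp_apply, hK, map_smul, hF, smul_smul]
    split_ifs <;> simp

end Existence

theorem mainTheorem4 {H : Type*} [NormedAddCommGroup H] [InnerProductSpace ℂ H] [CompleteSpace H]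
    (hH : ¬ FiniteDimensional ℂ H) (T : H →L[ℂ] H) :
    (IsPositiveAM T ↔
      ∃! d : ℝ × (H →L[ℂ] H) × (H →L[ℂ] H), IsAMDecomposition T d.1 d.2.1 d.2.2) ∧
    ∀ (α : ℝ) (K F : H →L[ℂ] H), IsAMDecomposition T α K F →
      (IsFirstType T ↔ FiniteDimensional ℂ (LinearMap.ker ((K - F : H →L[ℂ] H) : H →ₗ[ℂ] H))) ∧
      (IsSecondType T ↔
        ¬ FiniteDimensional ℂ (LinearMap.ker ((K - F : H →L[ℂ] H) : H →ₗ[ℂ] H))) := by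
  refine ⟨⟨fun hT => ?_, fun ⟨_, hd, _⟩ => hd.isPositiveAM⟩,
    fun _ _ _ h => ⟨h.isFirstType_iff, h.isSecondType_iff⟩⟩
  obtain ⟨α, K, F, h⟩ := hT.exists_isAMDecomposition hH
  refine ⟨(α, K, F), h, fun ⟨α', K', F'⟩ h' => ?_⟩
  obtain ⟨rfl, rfl, rfl⟩ := h'.eq_of_not_finiteDimensional hH h
  rfl
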